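/- For $n\ge 1$ let $\mathcal G_n$ denote the $2$-by-$n$ grid graph, that is, the graph with vertex set $\{0,1\}\times\{0,\dots,n-1\}$ in which two vertices are adjacent if and only if they agree in one coordinate and differ by exactly $1$ in the other. Let $T_n$ be the number of spanning trees of $\mathcal G_n$, and let $S_n$ be the number of balanced spanning trees of $\mathcal G_n$, where a spanning tree is called balanced if it contains an edge whose removal splits it into two connected components with equally many vertices. Let $m\ge 1$ be an integer. 1. If $n=2m+1$, then $$S_n = n+\sum_{i=0}^{m-1}(6+4i)\,T_{m-i}^2 .$$ 2. If $n=2m$, then $$S_n = n+2\,T_m^2+\sum_{i=1}^{m-1}(4+4i)\,T_{m-i}^2 .$$ -/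

import Mathlib

namespace BalancedTrees

/-- The `2`-by-`n` grid graph: vertices `(i, j)` with `i < 2` and `j < n`, two vertices being
adjacent when they agree in one coordinate and differ by one in the other. -/
def grid (n : ℕ) : SimpleGraph (Fin 2 × Fin n) :=
  (SimpleGraph.pathGraph 2).boxProd (SimpleGraph.pathGraph n)

/-- The spanning trees of `G`: trees on the whole vertex set of `G` all of whose edges are
edges of `G`. -/
def spanningTrees {V : Type*} (G : SimpleGraph V) : Set (SimpleGraph V) :=
  {T | T ≤ G ∧ T.IsTree}

/-- `e` is a balanced cut edge of `T`: it is an edge of `T`, and removing it partitions the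
vertices into exactly two connected components, which have the same number of vertices. -/
def IsBalancedCutEdge {V : Type*} (T : SimpleGraph V) (e : Sym2 V) : Prop :=
  e ∈ T.edgeSet ∧
    ∃ C D : (T.deleteEdges {e}).ConnectedComponent,
      C ≠ D ∧ (∀ X : (T.deleteEdges {e}).ConnectedComponent, X = C ∨ X = D) ∧
        C.supp.ncard = D.supp.ncard

/-- The balanced spanning trees of `G`: those that contain a balanced cut edge. -/
def balancedSpanningTrees {V : Type*} (G : SimpleGraph V) : Set (SimpleGraph V) :=
  {T | T ∈ spanningTrees G ∧ ∃ e, IsBalancedCutEdge T e}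

/-- The number of spanning trees of the `2`-by-`n` grid, with the convention that it is `1`
for `n = 0`. -/
noncomputable def numTrees (n : ℕ) : ℕ :=
  if n = 0 then 1 else (spanningTrees (grid n)).ncard

/-- The number of balanced spanning trees of the `2`-by-`n` grid. -/
noncomputable def numBalanced (n : ℕ) : ℕ :=
  (balancedSpanningTrees (grid n)).ncard

end BalancedTrees

/-!
A spanning tree is balanced exactly when some half `A` of the vertices and its complement both
induce subtrees. In the grid such an `A` containing the corner `(0, 0)` meets each row in an initial
segment, so it is a staircase with `i` and `n - i` vertices in the two rows. A tree cannot be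
balanced by two different staircases, hence the balanced trees are counted by summing over `i`. For
each `i`, a tree is made of a spanning tree of each half and one of the edges leaving the staircase.
Removing the pendant path of a half turns it into a grid with `min i (n - i)` columns, so each half
has `T` spanning trees for this number of columns, and both the number of trees and the number of
edges leaving the staircase are symmetric under `i ↦ n - i`.
-/

namespace BalancedTrees

open SimpleGraph

section Cuts

variable {V W : Type*} {G T : SimpleGraph V} {H : SimpleGraph W} {A B : Set V}

lemma exists_adj_mem_notMem {u v : V} (h : G.Reachable u v) (hu : u ∈ A) (hv : v ∉ A) :
    ∃ x ∈ A, ∃ y ∉ A, G.Adj x y := by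
  obtain ⟨p⟩ := h
  obtain ⟨d, -, hd, hd'⟩ := p.exists_boundary_dart A hu hv
  exact ⟨d.fst, hd, d.snd, hd', d.adj⟩

lemma exists_adj_inter_diff (hA : (G.induce A).Preconnected) (h : (A ∩ B).Nonempty)
    (h' : (A \ B).Nonempty) : ∃ x ∈ A ∩ B, ∃ y ∈ A \ B, G.Adj x y := by
  obtain ⟨u, huA, huB⟩ := h
  obtain ⟨v, hvA, hvB⟩ := h'
  obtain ⟨x, hx, y, hy, hxy⟩ :=
    exists_adj_mem_notMem (A := Subtype.val ⁻¹' B) (hA ⟨u, huA⟩ ⟨v, hvA⟩) huB hvB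
  exact ⟨x, ⟨x.2, hx⟩, y, ⟨y.2, hy⟩, hxy⟩

lemma reachable_deleteEdges_of_mem (hA : (T.induce A).Preconnected) {e : Sym2 V} {v x y : V}
    (hve : v ∈ e) (hv : v ∉ A) (hx : x ∈ A) (hy : y ∈ A) :
    (T.deleteEdges {e}).Reachable x y := by
  have hadj {p q : A} (h : (T.induce A).Adj p q) : (T.deleteEdges {e}).Adj p q := by
    rw [deleteEdges_adj]
    refine ⟨h, ?_⟩
    rintro rfl
    obtain rfl | rfl := Sym2.mem_iff.1 hve
    exacts [hv p.2, hv q.2]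
  exact (hA ⟨x, hx⟩ ⟨y, hy⟩).map ⟨Subtype.val, hadj⟩

/-- The edges of `G` leaving `A`, oriented outwards. -/
def crossing (G : SimpleGraph V) (A : Set V) : Set (V × V) :=
  {p | p.1 ∈ A ∧ p.2 ∉ A ∧ G.Adj p.1 p.2}

lemma crossing_subsingleton (hT : T.IsAcyclic) (hA : (T.induce A).Preconnected)
    (hA' : (T.induce Aᶜ).Preconnected) : (crossing T A).Subsingleton := by
  rintro ⟨a, b⟩ ⟨ha, hb, hab⟩ ⟨c, d⟩ ⟨hc, hd, hcd⟩
  by_contra hne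
  have hcd' : (T.deleteEdges {s(a, b)}).Adj c d := by
    rw [deleteEdges_adj]
    refine ⟨hcd, fun h => ?_⟩
    obtain ⟨rfl, rfl⟩ | ⟨rfl, rfl⟩ := Sym2.eq_iff.1 h
    exacts [hne rfl, hb hc]
  have hac : (T.deleteEdges {s(a, b)}).Reachable a c :=
    reachable_deleteEdges_of_mem hA (Sym2.mem_mk_right a b) hb ha hc
  have hdb : (T.deleteEdges {s(a, b)}).Reachable d b :=
    reachable_deleteEdges_of_mem hA' (Sym2.mem_mk_left a b) (not_not.2 ha) hd hb
  exact isBridge_iff.1 (isAcyclic_iff_forall_adj_isBridge.1 hT hab)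
    ((hac.trans hcd'.reachable).trans hdb)

lemma not_isCycle_of_mem (hclosed : ∀ u ∈ A, ∀ v, T.Adj u v → v ∈ A)
    (hA : (T.induce A).IsAcyclic) {u : V} (hu : u ∈ A) (c : T.Walk u u) : ¬c.IsCycle := by
  classical
  have hsupp : ∀ v ∈ c.support, v ∈ A := by
    intro v hv
    by_contra hvA
    obtain ⟨x, hx, y, hy, hxy⟩ := exists_adj_mem_notMem (c.takeUntil v hv).reachable hu hvA
    exact hy (hclosed x hx y hxy)
  intro hc
  refine hA (c.induce A hsupp) (.of_map (f := (Embedding.induce A).toHom) ?_)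
  rwa [c.map_induce hsupp]

lemma isAcyclic_of_crossing_eq_empty (h : crossing T A = ∅) (hA : (T.induce A).IsAcyclic)
    (hA' : (T.induce Aᶜ).IsAcyclic) : T.IsAcyclic := by
  intro u c
  by_cases hu : u ∈ A
  · refine not_isCycle_of_mem (fun x hx y hxy => ?_) hA hu c
    by_contra hy
    exact h.subset (show (x, y) ∈ crossing T A from ⟨hx, hy, hxy⟩)
  · refine not_isCycle_of_mem (fun x hx y hxy hy => ?_) hA' hu c
    exact h.subset (show (y, x) ∈ crossing T A from ⟨hy, hx, hxy.symm⟩)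

lemma isAcyclic_of_crossing_eq_singleton {p : V × V} (h : crossing T A = {p})
    (hA : (T.induce A).IsAcyclic) (hA' : (T.induce Aᶜ).IsAcyclic) : T.IsAcyclic := by
  obtain ⟨a, b⟩ := p
  obtain ⟨ha, hb, -⟩ := h.superset rfl
  set F := T.deleteEdges {s(a, b)} with hF
  have hFT : F ≤ T := T.deleteEdges_le _
  have hcrossing : crossing F A = ∅ := by
    refine Set.eq_empty_of_forall_notMem fun ⟨x, y⟩ ⟨hx, hy, hxy⟩ => ?_
    obtain ⟨rfl, rfl⟩ := Prod.mk.inj (h.subset (show (x, y) ∈ crossing T A from ⟨hx, hy, hFT hxy⟩))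
    simp [hF] at hxy
  have hFac : F.IsAcyclic :=
    isAcyclic_of_crossing_eq_empty hcrossing (hA.anti (comap_monotone _ hFT))
      (hA'.anti (comap_monotone _ hFT))
  have hnot : ¬F.Reachable a b := by
    intro hab
    obtain ⟨x, hx, y, hy, hxy⟩ := exists_adj_mem_notMem hab ha hb
    exact hcrossing.subset (show (x, y) ∈ crossing F A from ⟨hx, hy, hxy⟩)
  refine (hFac.sup_edge_of_not_reachable hnot).anti (le_sdiff_sup (a := edge a b))

lemma connected_of_crossing_nonempty (h : (crossing T A).Nonempty)
    (hA : (T.induce A).Preconnected) (hA' : (T.induce Aᶜ).Preconnected) : T.Connected := by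
  obtain ⟨⟨a, b⟩, ha, hb, hab⟩ := h
  rw [← (induceUnivIso T).connected_iff, ← Set.union_compl_self A]
  exact connected_induce_union hA hA' ha hb hab

lemma isTree_iff_crossing_eq_singleton (hA : (T.induce A).Connected)
    (hA' : (T.induce Aᶜ).Connected) :
    T.IsTree ↔ (T.induce A).IsAcyclic ∧ (T.induce Aᶜ).IsAcyclic ∧ ∃ p, crossing T A = {p} := by
  constructor
  · intro hT
    obtain ⟨⟨a, ha⟩⟩ := hA.nonempty
    obtain ⟨⟨b, hb⟩⟩ := hA'.nonempty
    obtain ⟨x, hx, y, hy, hxy⟩ := exists_adj_mem_notMem (hT.connected a b) ha hb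
    exact ⟨hT.isAcyclic.induce A, hT.isAcyclic.induce Aᶜ, (x, y),
      (crossing_subsingleton hT.isAcyclic hA.preconnected hA'.preconnected).eq_singleton_of_mem
        ⟨hx, hy, hxy⟩⟩
  · rintro ⟨hacA, hacA', ⟨a, b⟩, hab⟩
    obtain ⟨ha, hb, hadj⟩ := hab.superset rfl
    refine ⟨connected_of_crossing_nonempty ⟨_, ha, hb, hadj⟩ hA.preconnected hA'.preconnected,
      isAcyclic_of_crossing_eq_singleton hab hacA hacA'⟩

/-- The spanning trees of `G` that one edge removal separates into the parts `A` and `Aᶜ`. -/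
def splitTrees (G : SimpleGraph V) (A : Set V) : Set (SimpleGraph V) :=
  {T | T ∈ spanningTrees G ∧ (T.induce A).Connected ∧ (T.induce Aᶜ).Connected}

/-- The graph made of a graph on `A`, a graph on `Aᶜ` and an edge between them, inverse to cutting
a tree of `splitTrees G A` along its crossing edge. -/
def glue (T₁ : SimpleGraph A) (T₂ : SimpleGraph ↥Aᶜ) (a b : V) : SimpleGraph V :=
  T₁.spanningCoe ⊔ T₂.spanningCoe ⊔ edge a b

lemma glue_adj {T₁ : SimpleGraph A} {T₂ : SimpleGraph ↥Aᶜ} {a b u v : V} :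
    (glue T₁ T₂ a b).Adj u v ↔ (∃ hu hv, T₁.Adj ⟨u, hu⟩ ⟨v, hv⟩) ∨
      (∃ hu hv, T₂.Adj ⟨u, hu⟩ ⟨v, hv⟩) ∨ (edge a b).Adj u v := by
  simp [glue, or_assoc]

lemma induce_glue {T₁ : SimpleGraph A} {T₂ : SimpleGraph ↥Aᶜ} {a b : V} (hb : b ∉ A) :
    (glue T₁ T₂ a b).induce A = T₁ := by
  ext x y
  simp only [comap_adj, Function.Embedding.subtype_apply, glue_adj, edge_adj]
  grind

lemma induce_compl_glue {T₁ : SimpleGraph A} {T₂ : SimpleGraph ↥Aᶜ} {a b : V} (ha : a ∈ A) :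
    (glue T₁ T₂ a b).induce Aᶜ = T₂ := by
  ext x y
  simp only [comap_adj, Function.Embedding.subtype_apply, glue_adj, edge_adj]
  grind

lemma crossing_glue {T₁ : SimpleGraph A} {T₂ : SimpleGraph ↥Aᶜ} {a b : V} (ha : a ∈ A)
    (hb : b ∉ A) : crossing (glue T₁ T₂ a b) A = {(a, b)} := by
  ext ⟨x, y⟩
  simp only [crossing, glue_adj, edge_adj, Set.mem_ofPred_eq, Set.mem_singleton_iff]
  grind

lemma glue_le {T₁ : SimpleGraph A} {T₂ : SimpleGraph ↥Aᶜ} {a b : V} (h₁ : T₁ ≤ G.induce A)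
    (h₂ : T₂ ≤ G.induce Aᶜ) (hab : G.Adj a b) : glue T₁ T₂ a b ≤ G :=
  sup_le (sup_le ((map_le_iff_le_comap _ _ _).2 h₁) ((map_le_iff_le_comap _ _ _).2 h₂))
    ((edge_le_iff G).2 (.inr hab))

lemma eq_of_induce_eq {T T' : SimpleGraph V} (hA : T.induce A = T'.induce A)
    (hA' : T.induce Aᶜ = T'.induce Aᶜ) (h : crossing T A = crossing T' A) : T = T' := by
  ext u v
  have hinA (hu : u ∈ A) (hv : v ∈ A) : T.Adj u v ↔ T'.Adj u v :=
    iff_of_eq (congrArg (fun K : SimpleGraph A => K.Adj ⟨u, hu⟩ ⟨v, hv⟩) hA)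
  have hinA' (hu : u ∉ A) (hv : v ∉ A) : T.Adj u v ↔ T'.Adj u v :=
    iff_of_eq (congrArg (fun K : SimpleGraph ↥Aᶜ => K.Adj ⟨u, hu⟩ ⟨v, hv⟩) hA')
  have huv := Set.ext_iff.1 h (u, v)
  have hvu := Set.ext_iff.1 h (v, u)
  simp only [crossing, Set.mem_ofPred_eq] at huv hvu
  grind [T.adj_comm, T'.adj_comm]

lemma bijOn_splitTrees :
    Set.BijOn (fun T => (T.induce A, T.induce Aᶜ, crossing T A)) (splitTrees G A)
      (spanningTrees (G.induce A) ×ˢ spanningTrees (G.induce Aᶜ) ×ˢ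
        ((fun p => {p}) '' crossing G A)) := by
  refine ⟨?_, ?_, ?_⟩
  · rintro T ⟨⟨hle, hT⟩, hA, hA'⟩
    obtain ⟨hac, hac', p, hp⟩ := (isTree_iff_crossing_eq_singleton hA hA').1 hT
    obtain ⟨hp₁, hp₂, hadj⟩ := hp.superset rfl
    exact ⟨⟨comap_monotone _ hle, hA, hac⟩, ⟨comap_monotone _ hle, hA', hac'⟩,
      p, ⟨hp₁, hp₂, hle hadj⟩, hp.symm⟩
  · intro T _ T' _ h
    simp only [Prod.mk.injEq] at h
    exact eq_of_induce_eq h.1 h.2.1 h.2.2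
  · rintro ⟨T₁, T₂, _⟩ ⟨⟨hle₁, hT₁⟩, ⟨hle₂, hT₂⟩, ⟨a, b⟩, ⟨ha, hb, hab⟩, rfl⟩
    have h₁ : (glue T₁ T₂ a b).induce A = T₁ := induce_glue hb
    have h₂ : (glue T₁ T₂ a b).induce Aᶜ = T₂ := induce_compl_glue ha
    have hp : crossing (glue T₁ T₂ a b) A = {(a, b)} := crossing_glue ha hb
    have hA : ((glue T₁ T₂ a b).induce A).Connected := h₁.symm ▸ hT₁.connected
    have hA' : ((glue T₁ T₂ a b).induce Aᶜ).Connected := h₂.symm ▸ hT₂.connected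
    have hT : (glue T₁ T₂ a b).IsTree :=
      (isTree_iff_crossing_eq_singleton hA hA').2
        ⟨h₁.symm ▸ hT₁.isAcyclic, h₂.symm ▸ hT₂.isAcyclic, _, hp⟩
    exact ⟨glue T₁ T₂ a b, ⟨⟨glue_le hle₁ hle₂ hab, hT⟩, hA, hA'⟩, by simp only [h₁, h₂, hp]⟩

theorem ncard_splitTrees (G : SimpleGraph V) (A : Set V) :
    (splitTrees G A).ncard = (spanningTrees (G.induce A)).ncard *
      (spanningTrees (G.induce Aᶜ)).ncard * (crossing G A).ncard := by
  rw [bijOn_splitTrees.ncard_eq, Set.ncard_prod, Set.ncard_prod,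
    Set.ncard_image_of_injective _ Set.singleton_injective, mul_assoc]

lemma ncard_spanningTrees_congr (f : G ≃g H) :
    (spanningTrees G).ncard = (spanningTrees H).ncard := by
  have himage : f.toEquiv.simpleGraph.symm '' spanningTrees H = spanningTrees G := by
    ext T
    rw [Equiv.image_symm_eq_preimage]
    refine and_congr ?_ (Iso.comap f.toEquiv.symm T).isTree_iff
    refine ⟨fun h x y hxy => ?_, fun h x y hxy => ?_⟩
    · refine f.map_adj_iff.1 (h (?_ : T.Adj (f.symm (f x)) (f.symm (f y))))
      rwa [f.symm_apply_apply, f.symm_apply_apply]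
    · exact f.symm.map_adj_iff.1 (h hxy)
  rw [← himage, Set.ncard_image_of_injective _ f.toEquiv.simpleGraph.symm.injective]

lemma ncard_spanningTrees_of_subsingleton [Nonempty V] [Subsingleton V] (G : SimpleGraph V) :
    (spanningTrees G).ncard = 1 :=
  Set.ncard_eq_one.2 ⟨G, Set.eq_singleton_iff_unique_mem.2
    ⟨⟨le_rfl, .of_subsingleton⟩, fun _ _ => Subsingleton.elim _ _⟩⟩

lemma splitTrees_singleton {v w : V} (hv : G.neighborSet v = {w}) :
    splitTrees G {v} = spanningTrees G := by
  refine Set.Subset.antisymm (fun _ h => h.1) fun T hT => ⟨hT, IsTree.of_subsingleton.connected, ?_⟩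
  obtain ⟨hle, hT⟩ := hT
  have : Nontrivial V := ⟨v, w, Adj.ne (hv.superset rfl)⟩
  obtain ⟨u, hvu⟩ := hT.connected.preconnected.exists_adj_of_nontrivial v
  have hu {x : V} (hx : T.Adj v x) : x = w := hv.subset (hle hx)
  have := ((Set.finite_singleton w).subset fun x (hx : x ∈ T.neighborSet v) => hu hx).fintype
  exact hT.connected.induce_compl_singleton_of_degree_eq_one <|
    degree_eq_one_iff_existsUnique_adj.2 ⟨u, hvu, fun x hx => (hu hx).trans (hu hvu).symm⟩

lemma ncard_spanningTrees_of_neighborSet_eq_singleton {v w : V} (hv : G.neighborSet v = {w}) :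
    (spanningTrees G).ncard = (spanningTrees (G.induce {v}ᶜ)).ncard := by
  have hcrossing : crossing G {v} = {(v, w)} := by
    have hadj (x : V) : G.Adj v x ↔ x = w := Set.ext_iff.1 hv x
    ext ⟨x, y⟩
    simp only [crossing, Set.mem_singleton_iff, Set.mem_ofPred_eq, Prod.mk.injEq]
    grind [G.irrefl]
  rw [← splitTrees_singleton hv, ncard_splitTrees, ncard_spanningTrees_of_subsingleton, hcrossing,
    Set.ncard_singleton, one_mul, mul_one]

lemma supp_connectedComponentMk_deleteEdges (hT : T.IsAcyclic) {a b : V} (hab : T.Adj a b)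
    (ha : a ∈ A) (hb : b ∉ A) (hA : (T.induce A).Preconnected)
    (hA' : (T.induce Aᶜ).Preconnected) :
    ((T.deleteEdges {s(a, b)}).connectedComponentMk a).supp = A := by
  ext x
  rw [ConnectedComponent.mem_supp_iff, ConnectedComponent.eq]
  refine ⟨fun hxa => ?_, fun hx => reachable_deleteEdges_of_mem hA (Sym2.mem_mk_right a b) hb hx ha⟩
  by_contra hx
  exact isBridge_iff.1 (isAcyclic_iff_forall_adj_isBridge.1 hT hab) (hxa.symm.trans
    (reachable_deleteEdges_of_mem hA' (Sym2.mem_mk_left a b) (not_not.2 ha) hx hb))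

theorem exists_isBalancedCutEdge_iff (hT : T.IsTree) :
    (∃ e, IsBalancedCutEdge T e) ↔
      ∃ A : Set V, A.ncard = Aᶜ.ncard ∧ (T.induce A).Connected ∧ (T.induce Aᶜ).Connected := by
  constructor
  · rintro ⟨e, -, C, D, hne, hall, hcard⟩
    have hCD : D.supp = C.suppᶜ := by
      ext x
      simp only [Set.mem_compl_iff, ConnectedComponent.mem_supp_iff]
      have := hall (connectedComponentMk _ x)
      grind
    have hconn (X : (T.deleteEdges {e}).ConnectedComponent) : (T.induce X.supp).Connected :=
      X.connected_toSimpleGraph.mono (comap_monotone _ (T.deleteEdges_le _))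
    exact ⟨C.supp, hCD ▸ hcard, hconn C, hCD ▸ hconn D⟩
  · rintro ⟨A, hcard, hA, hA'⟩
    obtain ⟨-, -, ⟨a, b⟩, hp⟩ := (isTree_iff_crossing_eq_singleton hA hA').1 hT
    obtain ⟨ha, hb, hab⟩ := hp.superset rfl
    have hsuppA := supp_connectedComponentMk_deleteEdges hT.isAcyclic hab ha hb hA.preconnected
      hA'.preconnected
    have hsuppA' := supp_connectedComponentMk_deleteEdges (A := Aᶜ) hT.isAcyclic hab.symm hb
      (not_not.2 ha) hA'.preconnected ((compl_compl A).symm ▸ hA.preconnected)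
    rw [Sym2.eq_swap] at hsuppA'
    refine ⟨s(a, b), hab, connectedComponentMk _ a, connectedComponentMk _ b, ?_, ?_, ?_⟩
    · intro h
      rw [← h, hsuppA] at hsuppA'
      exact (hsuppA'.subset ha) ha
    · refine ConnectedComponent.ind fun x => ?_
      by_cases hx : x ∈ A
      · exact .inl (hsuppA.superset hx)
      · exact .inr (hsuppA'.superset hx)
    · rw [hsuppA, hsuppA', hcard]

/-- Otherwise `T` would have two edges leaving `A`, one inside `B` and one inside `Bᶜ`. -/
lemma union_eq_univ_of_isAcyclic (hT : T.IsAcyclic) (hA : (T.induce A).Preconnected)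
    (hA' : (T.induce Aᶜ).Preconnected) (hB : (T.induce B).Preconnected)
    (hB' : (T.induce Bᶜ).Preconnected) (hinter : (A ∩ B).Nonempty) (hdiff : (A \ B).Nonempty)
    (hdiff' : (B \ A).Nonempty) : A ∪ B = Set.univ := by
  by_contra hne
  obtain ⟨z, hz⟩ := (Set.ne_univ_iff_exists_notMem _).1 hne
  obtain ⟨a, ⟨haB, haA⟩, b, ⟨-, hbA⟩, hab⟩ :=
    exists_adj_inter_diff (B := A) hB (Set.inter_comm A B ▸ hinter) hdiff'
  obtain ⟨c, ⟨hcB, hcA⟩, d, ⟨-, hdA⟩, hcd⟩ :=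
    exists_adj_inter_diff (A := Bᶜ) (B := A) hB' (hdiff.mono fun x hx => hx.symm) ⟨z, by grind⟩
  have hac : (a, b) = (c, d) :=
    crossing_subsingleton hT hA hA' ⟨haA, hbA, hab⟩ ⟨hcA, hdA, hcd⟩
  exact hcB ((Prod.mk.inj hac).1 ▸ haB)

lemma ncard_spanningTrees_induce_range (f : G ↪g H) :
    (spanningTrees (H.induce (Set.range f))).ncard = (spanningTrees G).ncard :=
  (ncard_spanningTrees_congr f.isoInduceRange).symm

lemma ncard_spanningTrees_induce_image (f : G ↪g H) (A : Set V) :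
    (spanningTrees (H.induce (f '' A))).ncard = (spanningTrees (G.induce A)).ncard := by
  have hrange : Set.range ((Embedding.induce A).trans f : G.induce A ↪g H) = f '' A :=
    (Set.range_comp f Subtype.val).trans (congrArg (f '' ·) Subtype.range_val)
  rw [← hrange, ncard_spanningTrees_induce_range]

lemma ncard_spanningTrees_induce_insert {v w : V} (hv : v ∉ A) (h : G.neighborSet v ∩ A = {w}) :
    (spanningTrees (G.induce (insert v A))).ncard = (spanningTrees (G.induce A)).ncard := by
  have hw : w ∈ A := (h.superset rfl).2
  have hneighbor : (G.induce (insert v A)).neighborSet ⟨v, Set.mem_insert v A⟩ =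
      {⟨w, Set.mem_insert_of_mem v hw⟩} := by
    ext ⟨x, hx⟩
    have := Set.ext_iff.1 h x
    simp only [Set.mem_inter_iff, mem_neighborSet, Set.mem_singleton_iff, comap_adj,
      Function.Embedding.subtype_apply, Subtype.mk.injEq] at this ⊢
    grind [G.irrefl]
  have hrange : Set.range (G.induceHomOfLE (Set.subset_insert v A)) =
      {⟨v, Set.mem_insert v A⟩}ᶜ := by
    ext ⟨x, hx⟩
    simp only [induceHomOfLE_apply, Set.mem_range, Set.mem_compl_singleton_iff, Subtype.exists,
      Subtype.mk.injEq, ne_eq]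
    grind
  rw [ncard_spanningTrees_of_neighborSet_eq_singleton hneighbor, ← hrange,
    ncard_spanningTrees_induce_range]

end Cuts

section Staircases

variable {n i j k : ℕ}

lemma grid_adj {p q : Fin 2 × Fin n} :
    (grid n).Adj p q ↔ (p.1 ≠ q.1 ∧ p.2 = q.2) ∨
      (p.1 = q.1 ∧ ((p.2 : ℕ) + 1 = q.2 ∨ (q.2 : ℕ) + 1 = p.2)) := by
  simp only [grid, boxProd_adj, pathGraph_two_eq_top, top_adj, pathGraph_adj]
  tauto

/-- The half turn of the grid. It exchanges the two halves of a staircase decomposition. -/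
def halfTurn (n : ℕ) : grid n ≃g grid n where
  toEquiv := Fin.revPerm.prodCongr Fin.revPerm
  map_rel_iff' {p q} := by
    simp only [grid_adj, Equiv.prodCongr_apply, Prod.map_fst, Prod.map_snd, Fin.revPerm_apply,
      Fin.rev_inj, Fin.val_rev, ne_eq]
    lia

/-- The exchange of the two rows of the grid. -/
def rowSwap (n : ℕ) : grid n ≃g grid n where
  toEquiv := Fin.revPerm.prodCongr (Equiv.refl _)
  map_rel_iff' {p q} := by
    simp only [grid_adj, Equiv.prodCongr_apply, Prod.map_fst, Prod.map_snd, Fin.revPerm_apply,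
      Fin.rev_inj, Equiv.refl_apply, ne_eq]

/-- The inclusion of a grid as the leftmost columns of a longer one. -/
def gridInclusion (h : k ≤ n) : grid k ↪g grid n where
  toEmbedding := (Function.Embedding.refl _).prodMap (Fin.castLEEmb h)
  map_rel_iff' {p q} := by
    simp [grid_adj]

/-- The first `i` vertices of row `0` and the first `j` vertices of row `1`. -/
def staircase (n i j : ℕ) : Set (Fin 2 × Fin n) :=
  {p | (p.2 : ℕ) < ![i, j] p.1}

lemma mem_staircase {p : Fin 2 × Fin n} :
    p ∈ staircase n i j ↔ (p.1 = 0 ∧ (p.2 : ℕ) < i) ∨ (p.1 = 1 ∧ (p.2 : ℕ) < j) := by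
  obtain ⟨r, x⟩ := p
  fin_cases r <;> simp [staircase]

open Finset in
lemma ncard_staircase (hi : i ≤ n) (hj : j ≤ n) : (staircase n i j).ncard = i + j := by
  rw [staircase, Set.ncard_eq_toFinset_card', Set.toFinset_ofPred, card_filter,
    Fintype.sum_prod_type, Fin.sum_univ_two, ← card_filter, ← card_filter]
  change #{x : Fin n | x < i} + #{x : Fin n | x < j} = i + j
  rw [Fin.card_filter_val_lt, Fin.card_filter_val_lt, min_eq_right hi, min_eq_right hj]

lemma halfTurn_image_staircase (hij : i + j = n) :
    halfTurn n '' staircase n i j = (staircase n i j)ᶜ := by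
  refine ((halfTurn n).toEquiv.image_eq_preimage_symm _).trans ?_
  ext ⟨r, x⟩
  change (r.rev, x.rev) ∈ staircase n i j ↔ (r, x) ∉ staircase n i j
  simp only [mem_staircase, Fin.ext_iff, Fin.val_rev]
  lia

lemma rowSwap_image_staircase (n i j : ℕ) : rowSwap n '' staircase n i j = staircase n j i := by
  refine ((rowSwap n).toEquiv.image_eq_preimage_symm _).trans ?_
  ext ⟨r, x⟩
  change (r.rev, x) ∈ staircase n i j ↔ (r, x) ∈ staircase n j i
  simp only [mem_staircase, Fin.ext_iff, Fin.val_rev]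
  lia

lemma range_gridInclusion (h : k ≤ n) : Set.range (gridInclusion h) = staircase n k k := by
  ext ⟨r, x⟩
  rw [mem_staircase]
  constructor
  · rintro ⟨⟨s, y⟩, hy⟩
    obtain ⟨rfl, rfl⟩ := Prod.mk.inj hy
    simp only [Function.Embedding.refl_apply, Fin.castLEEmb_apply, Fin.val_castLE]
    lia
  · exact fun hx => ⟨(r, ⟨x, by lia⟩), rfl⟩

lemma ncard_spanningTrees_staircase_self (hk : 1 ≤ k) (h : k ≤ n) :
    (spanningTrees ((grid n).induce (staircase n k k))).ncard = numTrees k := by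
  rw [← range_gridInclusion h, ncard_spanningTrees_induce_range, numTrees, if_neg (by lia)]

lemma ncard_spanningTrees_staircase_one_zero (hn : 1 ≤ n) :
    (spanningTrees ((grid n).induce (staircase n 1 0))).ncard = numTrees 0 := by
  have hsingleton : staircase n 1 0 = {(0, ⟨0, hn⟩)} := by
    ext ⟨r, x⟩
    simp only [mem_staircase, Set.mem_singleton_iff, Prod.mk.injEq, Fin.ext_iff]
    lia
  rw [hsingleton, ncard_spanningTrees_of_subsingleton, numTrees, if_pos rfl]

lemma ncard_spanningTrees_staircase_succ (hi : 1 ≤ i) (hji : j ≤ i) (hin : i < n) :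
    (spanningTrees ((grid n).induce (staircase n (i + 1) j))).ncard =
      (spanningTrees ((grid n).induce (staircase n i j))).ncard := by
  have hinsert : staircase n (i + 1) j = insert (0, ⟨i, hin⟩) (staircase n i j) := by
    ext ⟨r, x⟩
    simp only [Set.mem_insert_iff, mem_staircase, Prod.mk.injEq, Fin.ext_iff]
    lia
  have hnotMem : (0, ⟨i, hin⟩) ∉ staircase n i j := by
    simp [mem_staircase]
  have hneighbor : (grid n).neighborSet (0, ⟨i, hin⟩) ∩ staircase n i j =
      {(0, ⟨i - 1, by lia⟩)} := by
    ext ⟨r, x⟩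
    simp only [Set.mem_inter_iff, mem_neighborSet, grid_adj, mem_staircase,
      Set.mem_singleton_iff, Prod.mk.injEq, Fin.ext_iff]
    lia
  rw [hinsert, ncard_spanningTrees_induce_insert hnotMem hneighbor]

lemma ncard_spanningTrees_staircase_of_le (hi : 1 ≤ i) (hji : j ≤ i) (hin : i ≤ n) :
    (spanningTrees ((grid n).induce (staircase n i j))).ncard = numTrees j := by
  obtain ⟨k, hk, hjk, hki, hbase⟩ : ∃ k, 1 ≤ k ∧ j ≤ k ∧ k ≤ i ∧
      (spanningTrees ((grid n).induce (staircase n k j))).ncard = numTrees j := by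
    rcases Nat.eq_zero_or_pos j with rfl | hj
    · exact ⟨1, le_rfl, Nat.zero_le _, hi, ncard_spanningTrees_staircase_one_zero (by lia)⟩
    · exact ⟨j, hj, le_rfl, hji, ncard_spanningTrees_staircase_self hj (by lia)⟩
  induction i, hki using Nat.le_induction with
  | base => exact hbase
  | succ i hki ih =>
    rw [ncard_spanningTrees_staircase_succ (by lia) (by lia) hin]
    exact ih (by lia) (by lia) (by lia)

theorem ncard_spanningTrees_staircase (hij : 1 ≤ i + j) (hi : i ≤ n) (hj : j ≤ n) :
    (spanningTrees ((grid n).induce (staircase n i j))).ncard = numTrees (min i j) := by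
  rcases le_total j i with h | h
  · rw [min_eq_right h]
    exact ncard_spanningTrees_staircase_of_le (by lia) h hi
  · rw [min_eq_left h, ← rowSwap_image_staircase]
    exact (ncard_spanningTrees_induce_image (rowSwap n).toEmbedding _).trans
      (ncard_spanningTrees_staircase_of_le (by lia) h hj)

theorem ncard_spanningTrees_compl_staircase (hn : 1 ≤ n) (hij : i + j = n) :
    (spanningTrees ((grid n).induce (staircase n i j)ᶜ)).ncard = numTrees (min i j) := by
  rw [← halfTurn_image_staircase hij]
  exact (ncard_spanningTrees_induce_image (halfTurn n).toEmbedding _).trans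
    (ncard_spanningTrees_staircase (by lia) (by lia) (by lia))

/-- The vertical edges of the grid leaving a staircase, oriented outwards. -/
def rungs (n i j : ℕ) : Set ((Fin 2 × Fin n) × (Fin 2 × Fin n)) :=
  {q ∈ crossing (grid n) (staircase n i j) | q.1.2 = q.2.2}

lemma bijOn_rungs (hi : i ≤ n) (hj : j ≤ n) :
    Set.BijOn (fun q => (q.1.2 : ℕ)) (rungs n i j) (Set.Ico (min i j) (max i j)) := by
  refine ⟨?_, ?_, ?_⟩
  · rintro ⟨⟨r, x⟩, ⟨s, y⟩⟩ ⟨⟨hx, hy, -⟩, hxy⟩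
    simp only [mem_staircase, Set.mem_Ico] at *
    lia
  · rintro ⟨⟨r, x⟩, ⟨s, y⟩⟩ ⟨⟨hx, hy, -⟩, hxy⟩ ⟨⟨r', x'⟩, ⟨s', y'⟩⟩ ⟨⟨hx', hy', -⟩, hxy'⟩ h
    simp only [mem_staircase, Prod.mk.injEq, Fin.ext_iff] at *
    lia
  · intro x hx
    rw [Set.mem_Ico] at hx
    have hxn : x < n := by lia
    rcases lt_or_ge x i with h | h
    · refine ⟨((0, ⟨x, hxn⟩), (1, ⟨x, hxn⟩)), ?_, rfl⟩
      simp only [rungs, crossing, mem_staircase, grid_adj, Set.mem_ofPred_eq]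
      lia
    · refine ⟨((1, ⟨x, hxn⟩), (0, ⟨x, hxn⟩)), ?_, rfl⟩
      simp only [rungs, crossing, mem_staircase, grid_adj, Set.mem_ofPred_eq]
      lia

lemma ncard_rungs (hi : i ≤ n) (hj : j ≤ n) : (rungs n i j).ncard = max i j - min i j := by
  rw [(bijOn_rungs hi hj).ncard_eq, ← Finset.coe_Ico, Set.ncard_coe_finset, Nat.card_Ico]

lemma ncard_crossing_row (n : ℕ) : (crossing (grid n) (staircase n n 0)).ncard = n := by
  have hrungs : rungs n n 0 = crossing (grid n) (staircase n n 0) := by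
    refine Set.sep_eq_self_iff_mem_true.2 ?_
    rintro ⟨⟨r, x⟩, ⟨s, y⟩⟩ ⟨hx, hy, hxy⟩
    simp only [mem_staircase, grid_adj] at *
    lia
  rw [← hrungs, ncard_rungs le_rfl n.zero_le, max_eq_left n.zero_le, min_eq_right n.zero_le,
    Nat.sub_zero]

lemma ncard_crossing_staircase (hi : 1 ≤ i) (hin : i < n) (hj : 1 ≤ j) (hjn : j < n) :
    (crossing (grid n) (staircase n i j)).ncard = max i j - min i j + 2 := by
  have hcrossing : crossing (grid n) (staircase n i j) =
      insert ((0, ⟨i - 1, by lia⟩), (0, ⟨i, hin⟩))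
        (insert ((1, ⟨j - 1, by lia⟩), (1, ⟨j, hjn⟩)) (rungs n i j)) := by
    ext ⟨⟨r, x⟩, ⟨s, y⟩⟩
    simp only [rungs, crossing, mem_staircase, grid_adj, Fin.ext_iff, Set.mem_ofPred_eq,
      Set.mem_insert_iff, Prod.mk.injEq]
    obtain ⟨rfl | rfl, rfl | rfl⟩ : (r = 0 ∨ r = 1) ∧ (s = 0 ∨ s = 1) := by lia
    all_goals lia
  rw [hcrossing, Set.ncard_insert_of_notMem _ (Set.toFinite _),
    Set.ncard_insert_of_notMem _ (Set.toFinite _), ncard_rungs hin.le hjn.le]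
  · simp only [rungs, Set.mem_ofPred_eq, Fin.mk.injEq]
    lia
  · simp only [rungs, Set.mem_ofPred_eq, Set.mem_insert_iff, Prod.mk.injEq, Fin.mk.injEq]
    lia

end Staircases

section Halves

variable {n i j : ℕ} {A : Set (Fin 2 × Fin n)}

lemma exists_horizontal_edge (hA : ((grid n).induce A).Preconnected) {p q : Fin 2 × Fin n}
    (hp : p ∈ A) (hq : q ∈ A) {x y : Fin n} (hxy : (x : ℕ) + 1 = y) (hpx : p.2 ≤ x)
    (hyq : y ≤ q.2) : ∃ r, (r, x) ∈ A ∧ (r, y) ∈ A := by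
  obtain ⟨⟨r, u⟩, ⟨hu, hux⟩, ⟨s, v⟩, ⟨hv, hxv⟩, hadj⟩ :=
    exists_adj_inter_diff (B := {p : Fin 2 × Fin n | p.2 ≤ x}) hA ⟨p, hp, hpx⟩
      ⟨q, hq, fun hqx : q.2 ≤ x => by lia⟩
  simp only [Set.mem_ofPred_eq, grid_adj] at hux hxv hadj
  obtain ⟨rfl, rfl, rfl⟩ : r = s ∧ u = x ∧ v = y := by lia
  exact ⟨r, hu, hv⟩

lemma injOn_snd_of_forall_column (hcard : A.ncard = n) (hcol : ∀ x, ∃ r, (r, x) ∈ A) :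
    A.InjOn Prod.snd := by
  have himage : Prod.snd '' A = Set.univ :=
    Set.eq_univ_of_forall fun x => (hcol x).imp' (·, x) fun _ h => ⟨h, rfl⟩
  refine Set.injOn_of_ncard_image_eq ?_ A.toFinite
  rw [himage, Set.ncard_univ, Nat.card_fin, hcard]

/-- Otherwise `A` would contain the whole column of `y`. As `Aᶜ` cannot pass this column, `A` would
then meet every column and have more than `n` vertices. -/
lemma mem_of_mem_succ (hcard : A.ncard = n) (hA : ((grid n).induce A).Preconnected)
    (hA' : ((grid n).induce Aᶜ).Preconnected)
    {r₀ : Fin 2} {x₀ : Fin n} (hx₀ : (x₀ : ℕ) = 0) (h₀ : (r₀, x₀) ∈ A) {r : Fin 2} {x y : Fin n}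
    (hxy : (x : ℕ) + 1 = y) (hy : (r, y) ∈ A) : (r, x) ∈ A := by
  by_contra hx
  obtain ⟨s, hsx, hsy⟩ := exists_horizontal_edge hA h₀ hy hxy (by lia) le_rfl
  have hsr : s ≠ r := by
    rintro rfl
    exact hx hsx
  have hfull (t : Fin 2) : (t, y) ∈ A := by
    obtain rfl | rfl : t = r ∨ t = s := by lia
    exacts [hy, hsy]
  refine hsr (Prod.mk.inj (injOn_snd_of_forall_column hcard (fun z => ?_) hsy hy rfl)).1
  rcases lt_trichotomy z y with hz | rfl | hz
  · obtain ⟨t, ht, -⟩ := exists_horizontal_edge (x := z) (y := ⟨z + 1, by lia⟩) hA h₀ hy rfl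
      (by lia) hz
    exact ⟨t, ht⟩
  · exact ⟨r, hy⟩
  · by_contra! hempty
    obtain ⟨t, ht, -⟩ := exists_horizontal_edge (x := y) (y := ⟨y + 1, by lia⟩) hA' hx (hempty 0)
      rfl (by lia) hz
    exact ht (hfull t)

lemma exists_forall_iff_lt {p : Fin n → Prop}
    (hp : ∀ x y : Fin n, (x : ℕ) + 1 = y → p y → p x) : ∃ i ≤ n, ∀ x : Fin n, p x ↔ x < i := by
  classical
  have hanti : Antitone fun k => ∃ h : k < n, p ⟨k, h⟩ :=
    antitone_nat_of_succ_le fun k ⟨h, hk⟩ => ⟨by lia, hp _ _ rfl hk⟩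
  have hex : ∃ k, ¬∃ h : k < n, p ⟨k, h⟩ := ⟨n, fun h => h.1.false⟩
  refine ⟨Nat.find hex, Nat.find_min' hex fun h => h.1.false, fun x => ⟨fun hx => ?_, fun hx => ?_⟩⟩
  · exact not_le.1 fun hle => Nat.find_spec hex (hanti hle ⟨x.2, hx⟩)
  · exact (not_not.1 (Nat.find_min hex hx)).2

theorem eq_staircase (hcard : A.ncard = n) (hA : ((grid n).induce A).Preconnected)
    (hA' : ((grid n).induce Aᶜ).Preconnected) {x₀ : Fin n} (hx₀ : (x₀ : ℕ) = 0) (h₀ : (0, x₀) ∈ A) :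
    ∃ i ∈ Finset.Icc 1 n, A = staircase n i (n - i) := by
  have hrow (r : Fin 2) : ∃ i ≤ n, ∀ x : Fin n, (r, x) ∈ A ↔ x < i :=
    exists_forall_iff_lt fun _ _ => mem_of_mem_succ hcard hA hA' hx₀ h₀
  obtain ⟨i, hi, hi'⟩ := hrow 0
  obtain ⟨j, hj, hj'⟩ := hrow 1
  have hAij : A = staircase n i j := by
    ext ⟨r, x⟩
    fin_cases r
    exacts [hi' x, hj' x]
  have hij : i + j = n := by rw [← ncard_staircase hi hj, ← hAij, hcard]
  have hi₀ := (hi' x₀).1 h₀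
  exact ⟨i, Finset.mem_Icc.2 ⟨by lia, hi⟩, by rw [hAij, ← hij, Nat.add_sub_cancel_left]⟩

theorem balancedSpanningTrees_grid (hn : 1 ≤ n) :
    balancedSpanningTrees (grid n) =
      ⋃ i ∈ (Finset.Icc 1 n : Set ℕ), splitTrees (grid n) (staircase n i (n - i)) := by
  ext T
  simp only [Set.mem_iUnion₂, Finset.mem_coe, exists_prop]
  constructor
  · rintro ⟨hT, he⟩
    obtain ⟨A, hcard, hA, hA', h₀⟩ : ∃ A : Set (Fin 2 × Fin n), A.ncard = Aᶜ.ncard ∧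
        (T.induce A).Connected ∧ (T.induce Aᶜ).Connected ∧ (0, ⟨0, hn⟩) ∈ A := by
      obtain ⟨A, hcard, hA, hA'⟩ := (exists_isBalancedCutEdge_iff hT.2).1 he
      by_cases h₀ : (0, ⟨0, hn⟩) ∈ A
      · exact ⟨A, hcard, hA, hA', h₀⟩
      · exact ⟨Aᶜ, by rw [compl_compl, hcard], hA', by rwa [compl_compl], h₀⟩
    have hsum : A.ncard + Aᶜ.ncard = 2 * n := by simpa using A.ncard_add_ncard_compl
    have hle (B : Set (Fin 2 × Fin n)) : T.induce B ≤ (grid n).induce B := comap_monotone _ hT.1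
    obtain ⟨i, hi, rfl⟩ := eq_staircase (by lia) (hA.preconnected.mono (hle A))
      (hA'.preconnected.mono (hle Aᶜ)) rfl h₀
    exact ⟨i, hi, hT, hA, hA'⟩
  · rintro ⟨i, hi, hT, hA, hA'⟩
    have hi := Finset.mem_Icc.1 hi
    have hcard : (staircase n i (n - i)).ncard = (staircase n i (n - i))ᶜ.ncard := by
      rw [← halfTurn_image_staircase (by lia),
        Set.ncard_image_of_injective _ (halfTurn n).injective]
    exact ⟨hT, (exists_isBalancedCutEdge_iff hT.2).2 ⟨_, hcard, hA, hA'⟩⟩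

lemma disjoint_splitTrees_staircase (hi : 1 ≤ i) (hij : i < j) (hj : j ≤ n) :
    Disjoint (splitTrees (grid n) (staircase n i (n - i)))
      (splitTrees (grid n) (staircase n j (n - j))) := by
  rw [Set.disjoint_left]
  rintro T ⟨hT, hA, hA'⟩ ⟨-, hB, hB'⟩
  have hunion := union_eq_univ_of_isAcyclic hT.2.isAcyclic hA.preconnected hA'.preconnected
    hB.preconnected hB'.preconnected
    ⟨(0, ⟨0, by lia⟩), by grind [mem_staircase]⟩
    ⟨(1, ⟨n - j, by lia⟩), by grind [mem_staircase]⟩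
    ⟨(0, ⟨i, by lia⟩), by grind [mem_staircase]⟩
  have hcorner : (1, ⟨n - 1, by lia⟩) ∈ staircase n i (n - i) ∪ staircase n j (n - j) :=
    hunion ▸ Set.mem_univ _
  simp only [Set.mem_union, mem_staircase] at hcorner
  lia

lemma pairwiseDisjoint_splitTrees_staircase (n : ℕ) :
    (Finset.Icc 1 n : Set ℕ).PairwiseDisjoint
      fun i => splitTrees (grid n) (staircase n i (n - i)) := by
  intro i hi j hj hij
  rw [Finset.mem_coe, Finset.mem_Icc] at hi hj
  rcases hij.lt_or_gt with h | h
  · exact disjoint_splitTrees_staircase hi.1 h hj.2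
  · exact (disjoint_splitTrees_staircase hj.1 h hi.2).symm

end Halves

section Counting

variable {n i : ℕ}

/-- The number of spanning trees of the `2`-by-`n` grid that one edge removal separates into
`staircase n i (n - i)` and its complement. -/
noncomputable def numSplit (n i : ℕ) : ℕ :=
  (splitTrees (grid n) (staircase n i (n - i))).ncard

lemma numSplit_eq_mul_ncard_crossing (hi : 1 ≤ i) (hin : i ≤ n) :
    numSplit n i =
      numTrees (min i (n - i)) ^ 2 * (crossing (grid n) (staircase n i (n - i))).ncard := by
  rw [numSplit, ncard_splitTrees, ncard_spanningTrees_staircase (by lia) hin (by lia),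
    ncard_spanningTrees_compl_staircase (by lia) (by lia), sq]

lemma numSplit_self (hn : 1 ≤ n) : numSplit n n = n := by
  rw [numSplit_eq_mul_ncard_crossing hn le_rfl, Nat.sub_self, ncard_crossing_row, Nat.min_zero,
    numTrees, if_pos rfl, one_pow, one_mul]

lemma numSplit_eq (hi : 1 ≤ i) (hin : i < n) :
    numSplit n i = (max i (n - i) - min i (n - i) + 2) * numTrees (min i (n - i)) ^ 2 := by
  rw [numSplit_eq_mul_ncard_crossing hi hin.le,
    ncard_crossing_staircase hi hin (by lia) (by lia), mul_comm]

lemma numSplit_of_two_mul_le (hi : 1 ≤ i) (hin : 2 * i ≤ n) :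
    numSplit n i = (n - 2 * i + 2) * numTrees i ^ 2 := by
  rw [numSplit_eq hi (by lia), max_eq_right (by lia), min_eq_left (by lia), Nat.sub_sub, two_mul]

lemma two_mul_numSplit_sub {m : ℕ} (r : ℕ) (hi : i < m) :
    2 * numSplit (2 * m + r) (m - i) = (4 + 2 * r + 4 * i) * numTrees (m - i) ^ 2 := by
  rw [numSplit_of_two_mul_le (by lia) (by lia), ← mul_assoc]
  congr 1
  lia

lemma numSplit_sub (hi : i ∈ Finset.Ico 1 n) : numSplit n (n - i) = numSplit n i := by
  rw [Finset.mem_Ico] at hi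
  rw [numSplit_eq hi.1 hi.2, numSplit_eq (by lia) (by lia), Nat.sub_sub_self hi.2.le, max_comm,
    min_comm]

theorem numBalanced_eq_sum_numSplit (hn : 1 ≤ n) :
    numBalanced n = n + ∑ i ∈ Finset.Ico 1 n, numSplit n i := by
  rw [numBalanced, balancedSpanningTrees_grid hn, Set.Finite.ncard_biUnion (Set.toFinite _)
    (fun _ _ => Set.toFinite _) (pairwiseDisjoint_splitTrees_staircase n), finsum_mem_coe_finset,
    ← Finset.Ico_insert_right hn, Finset.sum_insert Finset.right_notMem_Ico]
  exact congrArg (· + _) (numSplit_self hn)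

end Counting

lemma sum_Ico_sub_self_of_symm {n k : ℕ} {f : ℕ → ℕ}
    (hf : ∀ i ∈ Finset.Ico 1 n, f (n - i) = f i) (hk : k < n) :
    ∑ i ∈ Finset.Ico (n - k) n, f i = ∑ i ∈ Finset.Ico 1 (k + 1), f i := by
  calc ∑ i ∈ Finset.Ico (n - k) n, f i = ∑ i ∈ Finset.Ico 1 (k + 1), f (n - i) := by
        rw [Finset.sum_Ico_reflect f 1 (by lia), Nat.add_sub_add_right, Nat.add_sub_cancel]
    _ = ∑ i ∈ Finset.Ico 1 (k + 1), f i :=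
        Finset.sum_congr rfl fun i hi => hf i (Finset.Ico_subset_Ico_right hk hi)

lemma sum_Ico_two_mul_add_one_of_symm {m : ℕ} {f : ℕ → ℕ}
    (hf : ∀ i ∈ Finset.Ico 1 (2 * m + 1), f (2 * m + 1 - i) = f i) :
    ∑ i ∈ Finset.Ico 1 (2 * m + 1), f i = 2 * ∑ i ∈ Finset.range m, f (m - i) := by
  have hright := sum_Ico_sub_self_of_symm hf (by lia : m < 2 * m + 1)
  have hreflect : ∑ i ∈ Finset.Ico 1 (m + 1), f i = ∑ i ∈ Finset.range m, f (m - i) := by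
    rw [Finset.range_eq_Ico, Finset.sum_Ico_reflect f 0 m.le_succ, Nat.add_sub_cancel_left,
      Nat.sub_zero]
  rw [show 2 * m + 1 - m = m + 1 by lia] at hright
  rw [← Finset.sum_Ico_consecutive f (by lia : 1 ≤ m + 1) (by lia), hright, hreflect, two_mul]

lemma sum_Ico_two_mul_of_symm {m : ℕ} {f : ℕ → ℕ} (hm : 1 ≤ m)
    (hf : ∀ i ∈ Finset.Ico 1 (2 * m), f (2 * m - i) = f i) :
    ∑ i ∈ Finset.Ico 1 (2 * m), f i = f m + 2 * ∑ i ∈ Finset.Ico 1 m, f (m - i) := by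
  have hright := sum_Ico_sub_self_of_symm hf (by lia : m - 1 < 2 * m)
  have hreflect : ∑ i ∈ Finset.Ico 1 m, f i = ∑ i ∈ Finset.Ico 1 m, f (m - i) := by
    rw [Finset.sum_Ico_reflect f 1 m.le_succ, Nat.add_sub_cancel_left, Nat.add_sub_cancel]
  rw [show 2 * m - (m - 1) = m + 1 by lia, Nat.sub_add_cancel hm] at hright
  rw [← Finset.sum_Ico_consecutive f hm (by lia : m ≤ 2 * m),
    Finset.sum_eq_sum_Ico_succ_bot (by lia : m < 2 * m), hright, hreflect]
  ring

end BalancedTrees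

open BalancedTrees in
theorem lemma1 (m : ℕ) (hm : 1 ≤ m) :
    (∀ n : ℕ, n = 2 * m + 1 →
      BalancedTrees.numBalanced n =
        n + ∑ i ∈ Finset.range m, (6 + 4 * i) * BalancedTrees.numTrees (m - i) ^ 2) ∧
    (∀ n : ℕ, n = 2 * m →
      BalancedTrees.numBalanced n =
        n + 2 * BalancedTrees.numTrees m ^ 2 +
          ∑ i ∈ Finset.Ico 1 m, (4 + 4 * i) * BalancedTrees.numTrees (m - i) ^ 2) := by
  constructor
  · rintro n rfl
    rw [numBalanced_eq_sum_numSplit (by lia),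
      sum_Ico_two_mul_add_one_of_symm fun _ => numSplit_sub, Finset.mul_sum,
      Finset.sum_congr rfl fun i hi => two_mul_numSplit_sub 1 (Finset.mem_range.1 hi)]
  · rintro n rfl
    rw [numBalanced_eq_sum_numSplit (by lia), sum_Ico_two_mul_of_symm hm fun _ => numSplit_sub,
      numSplit_of_two_mul_le hm le_rfl, Nat.sub_self, zero_add, ← add_assoc, Finset.mul_sum]
    exact congrArg _ (Finset.sum_congr rfl fun i hi =>
      two_mul_numSplit_sub 0 (Finset.mem_Ico.1 hi).2)
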